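/- Let $k\ge 2$ and $1\le i\le k$ be integers, and let $q\in\mathbb{C}$ with $|q|<1$. Fix a square root $q^{1/2}$ of $q$ and write $q^{m/2}=(q^{1/2})^m$ for integers $m\ge 0$. Put $(a;p)_n=\prod_{j=0}^{n-1}(1-ap^j)$ and, for $|p|<1$, $(a;p)_\infty=\prod_{j\ge 0}(1-ap^j)$ and $(a_1,a_2,a_3;p)_\infty=(a_1;p)_\infty(a_2;p)_\infty(a_3;p)_\infty$. For integers $n_1,\dots,n_k\ge 0$ let $N_l=n_l+n_{l+1}+\cdots+n_k$ for $1\le l\le k$, and $N_l=0$ for $l>k$. Then the following series converges absolutely, and $$\sum_{n_1,\dots,n_k\ge 0}\frac{q^{\frac12(N_1^2+\cdots+N_k^2)+N_i+N_{i+2}+N_{i+4}+\cdots}}{(q;q)_{n_1}\cdots(q;q)_{n_{k-1}}(q^2;q^2)_{n_k}}=\frac{(-q^{1/2};q)_\infty\,\bigl(q^{i/2},\,q^{(2k-i+3)/2},\,q^{(2k+3)/2};\,q^{(2k+3)/2}\bigr)_\infty}{(q;q)_\infty}.$$ -/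

import Mathlib

namespace Warnaar

open Finset

/-- The finite `q`-shifted factorial `(a;q)_n = ∏_{j=0}^{n-1} (1 - a q^j)`. -/
noncomputable def qPoch (a q : ℂ) (n : ℕ) : ℂ :=
  ∏ j ∈ range n, (1 - a * q ^ j)

/-- The infinite `q`-shifted factorial `(a;q)_∞ = ∏_{j≥0} (1 - a q^j)`, meant for `|q| < 1`. -/
noncomputable def qPochInf (a q : ℂ) : ℂ :=
  ∏' j : ℕ, (1 - a * q ^ j)

/-- For `|q| < 1` the product that defines `(a;q)_∞` converges, whatever `a` is. -/
theorem multipliable_qPochInf (a q : ℂ) (hq : ‖q‖ < 1) :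
    Multipliable fun j : ℕ => 1 - a * q ^ j := by
  have h : Summable fun j : ℕ => ‖-(a * q ^ j)‖ := by
    simp only [norm_neg, norm_mul, norm_pow]
    exact (summable_geometric_of_lt_one (norm_nonneg q) hq).mul_left _
  simpa [sub_eq_add_neg] using multipliable_one_add_of_summable h

/-- `N_l = n_l + n_{l+1} + ⋯ + n_k`, where the tuple `(n_1, …, n_k)` is given as a function on
`Fin k`, the entry `n_j` being its value at the index `j - 1`. In particular `N_l = 0` for
`l > k`. -/
def tailSum {k : ℕ} (n : Fin k → ℕ) (l : ℕ) : ℕ :=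
  ∑ j : Fin k with l ≤ j.val + 1, n j

/-- The sum `N_1^2 + ⋯ + N_k^2`. -/
def sqSum {k : ℕ} (n : Fin k → ℕ) : ℕ :=
  ∑ l ∈ Icc 1 k, tailSum n l ^ 2

/-- The sum `N_i + N_{i+2} + N_{i+4} + ⋯`, over the indices `i ≤ l ≤ k` of the parity of `i`. -/
def altSum {k : ℕ} (i : ℕ) (n : Fin k → ℕ) : ℕ :=
  ∑ l ∈ Icc i k with l % 2 = i % 2, tailSum n l

/-- The denominator `(q;q)_{n_1} ⋯ (q;q)_{n_{k-1}} (q^2;q^2)_{n_k}`. -/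
noncomputable def denom {k : ℕ} (q : ℂ) (n : Fin k → ℕ) : ℂ :=
  ∏ j : Fin k, if j.val + 1 = k then qPoch (q ^ 2) (q ^ 2) (n j) else qPoch q q (n j)

end Warnaar

namespace Warnaar

open Finset Filter Topology

/-! Write q = s^2 and K_r(n) = (-s;q)_n / ((q;q)_{n-r} (q;q)_{n+r}). By q-Chu-Vandermonde
(`sum_kernel`), K_r is an eigenvector, with eigenvalue s^(r^2), of the Bailey transform f ↦ ∑_n
s^(n^2) f(n) / (q;q)_{L-n}. The multiple sum is an iterate of this transform, applied to
1/(q^2;q^2)_n and let to L → ∞. So it suffices to expand that seed in the K_r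
(`inv_qPoch_eq_sum_kernel`) and to follow the coefficients.

The expansions have the form ∑ c_r (K_r - s^((2r+1)m) K_{r+1}). A plain step multiplies c_r by
s^(r^2) and raises m by 1, as (r+1)^2 - r^2 = 2r+1. A linear factor q^N lowers m from 2 to 0
(`kernel_mul_pow`), and the transform brings it back to 1. Hence linear factors occur at every
second step from N_i on, and m is always the current index (`bailey_eq_sum_kernel`).

As L → ∞ all K_r have the same limit. What remains is a theta series, evaluated by the Jacobi triple
product (`tsum_thetaTerm`). -/

/-! ### Finite q-factorials, q-Pascal and q-Chu-Vandermonde -/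

theorem qPoch_zero (a q : ℂ) : qPoch a q 0 = 1 := by simp [qPoch]

theorem qPoch_succ (a q : ℂ) (n : ℕ) : qPoch a q (n + 1) = qPoch a q n * (1 - a * q ^ n) := by
  simp [qPoch, prod_range_succ]

theorem qPoch_add (a q : ℂ) (m n : ℕ) :
    qPoch a q (m + n) = qPoch a q m * qPoch (a * q ^ m) q n := by
  simp only [qPoch, prod_range_add, pow_add, mul_assoc]

theorem qPoch_succ' (a q : ℂ) (n : ℕ) :
    qPoch a q (n + 1) = (1 - a) * qPoch (a * q) q n := by
  rw [add_comm, qPoch_add]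
  simp [qPoch]

theorem one_sub_pow_ne_zero {q : ℂ} (hq : ‖q‖ < 1) (n : ℕ) : 1 - q ^ (n + 1) ≠ 0 := by
  intro h
  have h1 : ‖q ^ (n + 1)‖ < 1 := by
    rw [norm_pow]; exact pow_lt_one₀ (norm_nonneg _) hq (Nat.succ_ne_zero n)
  rw [← sub_eq_zero.1 h] at h1
  simp at h1

theorem qPoch_self_ne_zero {q : ℂ} (hq : ‖q‖ < 1) (n : ℕ) : qPoch q q n ≠ 0 := by
  rw [qPoch, prod_ne_zero_iff]
  intro j _
  rw [← pow_succ']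
  exact one_sub_pow_ne_zero hq j

/-- The reciprocal `1 / (q;q)_n`. -/
noncomputable def recip (q : ℂ) (n : ℕ) : ℂ := (qPoch q q n)⁻¹

theorem recip_zero (q : ℂ) : recip q 0 = 1 := by simp [recip, qPoch_zero]

theorem recip_succ {q : ℂ} (hq : ‖q‖ < 1) (n : ℕ) :
    (1 - q ^ (n + 1)) * recip q (n + 1) = recip q n := by
  have h1 := one_sub_pow_ne_zero hq n
  rw [recip, recip, qPoch_succ, ← pow_succ', mul_inv]
  field_simp

theorem choose_two_succ (n : ℕ) : (n + 1).choose 2 = n + n.choose 2 := by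
  rw [Nat.choose_succ_succ' n 1, Nat.choose_one_right]

/-- Quadratic exponents are reduced to multiples of `choose 2`, so that `ring` can compare powers
without division. -/
theorem add_two_mul_choose_two (n : ℕ) : n + 2 * n.choose 2 = n ^ 2 := by
  induction n with
  | zero => rfl
  | succ n ih => rw [choose_two_succ, add_sq, ← ih]; ring

/-- The `q`-Pascal rule, summed against an arbitrary function. -/
theorem sum_pascal {q : ℂ} (hq : ‖q‖ < 1) (N : ℕ) (f : ℕ → ℕ → ℂ) :
    (1 - q ^ (N + 1)) * ∑ p ∈ antidiagonal (N + 1), recip q p.1 * recip q p.2 * f p.1 p.2 =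
      ∑ p ∈ antidiagonal N,
        recip q p.1 * recip q p.2 * (f p.1 (p.2 + 1) + q ^ p.2 * f (p.1 + 1) p.2) := by
  -- Split 1 - q^(a+c) = (1 - q^c) + q^c (1 - q^a); each factor lowers one reciprocal.
  have h1 : (1 - q ^ (N + 1)) * ∑ p ∈ antidiagonal (N + 1),
      recip q p.1 * recip q p.2 * f p.1 p.2 =
      ∑ p ∈ antidiagonal (N + 1), recip q p.1 * ((1 - q ^ p.2) * recip q p.2) * f p.1 p.2 +
      ∑ p ∈ antidiagonal (N + 1),
        ((1 - q ^ p.1) * recip q p.1) * recip q p.2 * (q ^ p.2 * f p.1 p.2) := by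
    rw [mul_sum, ← sum_add_distrib]
    refine sum_congr rfl fun p hp => ?_
    rw [← HasAntidiagonal.mem_antidiagonal.1 hp]
    ring
  rw [h1, Finset.Nat.sum_antidiagonal_succ', Finset.Nat.sum_antidiagonal_succ]
  simp only [pow_zero, sub_self, zero_mul, mul_zero, zero_add, recip_succ hq]
  rw [← sum_add_distrib]
  refine sum_congr rfl fun p _ => ?_
  ring

theorem sum_pascal' {q : ℂ} (hq : ‖q‖ < 1) (N : ℕ) (f : ℕ → ℕ → ℂ) :
    (1 - q ^ (N + 1)) * ∑ p ∈ antidiagonal (N + 1), recip q p.1 * recip q p.2 * f p.1 p.2 =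
      ∑ p ∈ antidiagonal N,
        recip q p.1 * recip q p.2 * (q ^ p.1 * f p.1 (p.2 + 1) + f (p.1 + 1) p.2) := by
  have h := sum_pascal hq N fun a b => f b a
  rw [← Finset.Nat.sum_antidiagonal_swap, ← Finset.Nat.sum_antidiagonal_swap (n := N)] at h
  simp only [Prod.fst_swap, Prod.snd_swap] at h
  simp only [mul_comm (recip q (Prod.snd _))] at h
  rw [h]
  exact sum_congr rfl fun p _ => by ring

/-- The `q`-Chu-Vandermonde summation. -/
theorem sum_chu_vandermonde {q : ℂ} (hq : ‖q‖ < 1) (M : ℕ) (b w : ℂ) :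
    ∑ p ∈ antidiagonal M, recip q p.1 * recip q p.2 *
      (qPoch b q p.1 * (-w) ^ p.1 * q ^ (p.1.choose 2) * qPoch (b * w * q ^ p.1) q p.2) =
      recip q M * qPoch w q M := by
  induction M generalizing b with
  | zero => simp [recip_zero, qPoch_zero]
  | succ M ih =>
    apply mul_left_cancel₀ (one_sub_pow_ne_zero hq M)
    rw [sum_pascal hq M fun a c => qPoch b q a * (-w) ^ a * q ^ (a.choose 2) *
      qPoch (b * w * q ^ a) q c]
    rw [← mul_assoc, recip_succ hq, qPoch_succ]
    -- The two Pascal halves are the induction hypothesis at b and at bq; their prefactors add up to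
    -- 1 - w q^M.
    trans (1 - b * w * q ^ M) * (recip q M * qPoch w q M) +
      (-w * q ^ M * (1 - b)) * (recip q M * qPoch w q M)
    · nth_rw 1 [← ih b]
      rw [← ih (b * q), mul_sum, mul_sum, ← sum_add_distrib]
      refine sum_congr rfl fun p hp => ?_
      rw [← HasAntidiagonal.mem_antidiagonal.1 hp, qPoch_succ, qPoch_succ', choose_two_succ]
      have : b * w * q ^ (p.1 + 1) = b * q * w * q ^ p.1 := by ring
      rw [this]
      ring
    · ring

/-! ### The kernels and the Bailey transform -/

/-- `1 / ((q;q)_{n-r} (q;q)_{n+r})`, to be read as `0` if `r > n`. -/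
noncomputable def pairRecip (q : ℂ) (r n : ℕ) : ℂ :=
  if r ≤ n then recip q (n - r) * recip q (n + r) else 0

theorem pairRecip_add (q : ℂ) (r m : ℕ) :
    pairRecip q r (r + m) = recip q m * recip q (2 * r + m) := by
  rw [pairRecip, if_pos (Nat.le_add_right _ _), Nat.add_sub_cancel_left]
  congr 2; ring

theorem pairRecip_of_lt (q : ℂ) {r n : ℕ} (h : n < r) : pairRecip q r n = 0 := by
  rw [pairRecip, if_neg (by omega)]

theorem pairRecip_succ {q : ℂ} (hq : ‖q‖ < 1) (r m : ℕ) :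
    (1 - q ^ m) * pairRecip q r (r + m) =
      (1 - q ^ (2 * r + m + 1)) * pairRecip q (r + 1) (r + m) := by
  cases m with
  | zero => simp [pairRecip_of_lt]
  | succ m =>
    have h : r + (m + 1) = r + 1 + m := by ring
    rw [pairRecip_add, h, pairRecip_add, ← mul_assoc, recip_succ hq,
      show 2 * (r + 1) + m = 2 * r + (m + 1) + 1 by ring, mul_left_comm, recip_succ hq]

/-- The kernel `(-s;q)_n / ((q;q)_{n-r} (q;q)_{n+r})` with `q = s ^ 2`. -/
noncomputable def kernel (s : ℂ) (r n : ℕ) : ℂ :=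
  qPoch (-s) (s ^ 2) n * pairRecip (s ^ 2) r n

theorem norm_sq_lt_one {s : ℂ} (hs : ‖s‖ < 1) : ‖s ^ 2‖ < 1 := by
  rw [norm_pow]; exact pow_lt_one₀ (norm_nonneg _) hs two_ne_zero

/-- The kernels are eigenvectors of the Bailey transform. -/
theorem sum_kernel {s : ℂ} (hs : ‖s‖ < 1) (r L : ℕ) :
    ∑ p ∈ antidiagonal L, recip (s ^ 2) p.1 * (s ^ (p.2 ^ 2) * kernel s r p.2) =
      s ^ (r ^ 2) * kernel s r L := by
  have hq := norm_sq_lt_one hs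
  rw [← Finset.Nat.sum_antidiagonal_swap]
  simp only [Prod.fst_swap, Prod.snd_swap]
  rcases lt_or_ge L r with h | h
  · rw [kernel, pairRecip_of_lt _ h, mul_zero, mul_zero]
    refine sum_eq_zero fun p hp => ?_
    have := HasAntidiagonal.mem_antidiagonal.1 hp
    rw [kernel, pairRecip_of_lt _ (by omega), mul_zero, mul_zero, mul_zero]
  · obtain ⟨M, rfl⟩ := Nat.exists_eq_add_of_le h
    have h2 : ∑ p ∈ antidiagonal (r + M),
        recip (s ^ 2) p.2 * (s ^ (p.1 ^ 2) * kernel s r p.1) =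
        ∑ p ∈ antidiagonal M,
          recip (s ^ 2) p.2 * (s ^ ((r + p.1) ^ 2) * kernel s r (r + p.1)) := by
      symm
      refine sum_of_injOn (fun p => (r + p.1, p.2)) ?_ ?_ ?_ ?_
      · intro p _ p' _ hpp
        simp only [Prod.mk.injEq] at hpp
        exact Prod.ext (by omega) hpp.2
      · intro p hp
        have := HasAntidiagonal.mem_antidiagonal.1 (mem_coe.1 hp)
        simp only [mem_coe, HasAntidiagonal.mem_antidiagonal]
        omega
      · intro p hp hp'
        have hp1 := HasAntidiagonal.mem_antidiagonal.1 hp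
        have : p.1 < r := by
          by_contra hlt
          apply hp'
          refine ⟨(p.1 - r, p.2), ?_, ?_⟩
          · simp only [mem_coe, HasAntidiagonal.mem_antidiagonal]; omega
          · refine Prod.ext ?_ rfl
            simp only; omega
        rw [kernel, pairRecip_of_lt _ this, mul_zero, mul_zero, mul_zero]
      · intro p _; rfl
    rw [h2]
    -- With b = w = -s q^r, bw = q^(2r+1) turns the last factor into (q;q)_{2r+M} / (q;q)_{2r+m},
    -- and (-w)^m q^(m choose 2) = s^((r+m)^2 - r^2).
    have h3 := sum_chu_vandermonde hq M (-s * (s ^ 2) ^ r) (-s * (s ^ 2) ^ r)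
    have hne := qPoch_self_ne_zero hq (2 * r + M)
    have h4 : ∀ p ∈ antidiagonal M,
        recip (s ^ 2) p.2 * (s ^ ((r + p.1) ^ 2) * kernel s r (r + p.1)) =
        s ^ (r ^ 2) * qPoch (-s) (s ^ 2) r * recip (s ^ 2) (2 * r + M) *
        (recip (s ^ 2) p.1 * recip (s ^ 2) p.2 *
      (qPoch (-s * (s ^ 2) ^ r) (s ^ 2) p.1 * (-(-s * (s ^ 2) ^ r)) ^ p.1 *
        (s ^ 2) ^ (p.1.choose 2) *
        qPoch (-s * (s ^ 2) ^ r * (-s * (s ^ 2) ^ r) * (s ^ 2) ^ p.1) (s ^ 2) p.2)) := by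
      intro p hp
      have hM := HasAntidiagonal.mem_antidiagonal.1 hp
      have hne1 := qPoch_self_ne_zero hq (2 * r + p.1)
      have e1 : -s * (s ^ 2) ^ r * (-s * (s ^ 2) ^ r) * (s ^ 2) ^ p.1 =
          s ^ 2 * (s ^ 2) ^ (2 * r + p.1) := by ring
      have e2 : recip (s ^ 2) (2 * r + M) * qPoch (s ^ 2 * (s ^ 2) ^ (2 * r + p.1)) (s ^ 2) p.2 =
          recip (s ^ 2) (2 * r + p.1) := by
        rw [recip, recip, ← hM, ← add_assoc, qPoch_add (s ^ 2) (s ^ 2) (2 * r + p.1)]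
        rw [← hM, ← add_assoc, qPoch_add] at hne
        have := right_ne_zero_of_mul hne
        field_simp
      have e3 : (-(-s * (s ^ 2) ^ r)) ^ p.1 * (s ^ 2) ^ (p.1.choose 2) * s ^ (r ^ 2) =
          s ^ ((r + p.1) ^ 2) := by
        have h7 : (r + p.1) ^ 2 = (p.1 + 2 * p.1.choose 2) + 2 * r * p.1 + r ^ 2 := by
          rw [add_two_mul_choose_two]; ring
        rw [h7]; ring
      rw [e1, ← e3, kernel, pairRecip_add, ← e2, qPoch_add (-s) (s ^ 2) r]
      ring
    rw [sum_congr rfl h4, ← mul_sum, h3, kernel, pairRecip_add, qPoch_add (-s) (s ^ 2) r]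
    ring

/-- This is (1 - q^(n-r)) K_r = (1 - q^(n+r+1)) K_{r+1}, multiplied by q^r and rearranged. It
absorbs the linear weight q^n. -/
theorem kernel_mul_pow {s : ℂ} (hs : ‖s‖ < 1) (r n : ℕ) :
    s ^ (2 * n) * (kernel s r n - s ^ (4 * r + 2) * kernel s (r + 1) n) =
      s ^ (2 * r) * (kernel s r n - kernel s (r + 1) n) := by
  have hq := norm_sq_lt_one hs
  rcases lt_or_ge n r with h | h
  · simp [kernel, pairRecip_of_lt _ h, pairRecip_of_lt _ (h.trans (Nat.lt_succ_self r))]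
  · obtain ⟨m, rfl⟩ := Nat.exists_eq_add_of_le h
    have := pairRecip_succ hq r m
    simp only [kernel]
    linear_combination -(s ^ (2 * r) * qPoch (-s) (s ^ 2) (r + m)) * this

/-! ### Kernel expansions of the seed -/

/-- Telescoping in `r` of the difference of the two expansions of `q ^ n / (q ^ 2; q ^ 2)_n`. -/
theorem sum_pairRecip_sub {s : ℂ} (hs : ‖s‖ < 1) (n R : ℕ) (hR : R ≤ n + 1) :
    ∑ r ∈ range R, (-1) ^ r * s ^ (r ^ 2 + (r + 1).choose 2) *
      (s ^ (2 * n) * (pairRecip (s ^ 2) r n - s ^ (2 * r + 1) * pairRecip (s ^ 2) (r + 1) n) -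
        s ^ r * (pairRecip (s ^ 2) r n - pairRecip (s ^ 2) (r + 1) n)) =
      (-1) ^ R * s ^ (3 * R.choose 2 + 2 * n + R) * (1 - s ^ R) * pairRecip (s ^ 2) R n := by
  induction R with
  | zero => simp
  | succ r ih =>
    rw [sum_range_succ, ih (by omega)]
    obtain ⟨m, rfl⟩ := Nat.exists_eq_add_of_le (show r ≤ n by omega)
    have h := pairRecip_succ (norm_sq_lt_one hs) r m
    rw [← add_two_mul_choose_two r, choose_two_succ]
    linear_combination (-(-1) ^ r * s ^ (3 * r.choose 2 + 3 * r)) * h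

/-- Telescoping in `r` of the step from `n` to `n + 1` in the proof of `sum_pairRecip`. -/
theorem sum_pairRecip_step {s : ℂ} (hs : ‖s‖ < 1) (n R : ℕ) (hR : R ≤ n + 1) :
    ∑ r ∈ range R, (-1) ^ r * s ^ (r ^ 2 + (r + 1).choose 2) *
      ((1 - s ^ (2 * r + 1)) * (recip (s ^ 2) (n - r) * recip (s ^ 2) (n + r + 1)) -
        (1 - s ^ (4 * n + 4)) * (pairRecip (s ^ 2) r (n + 1) -
          s ^ (2 * r + 1) * pairRecip (s ^ 2) (r + 1) (n + 1))) =
      (-1) ^ R * s ^ (2 * n + 2 + 3 * R.choose 2) *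
        ((1 - s ^ (2 * (n + 1 + R))) * pairRecip (s ^ 2) R (n + 1) -
        s ^ (3 * R) * ((1 - s ^ (2 * (n + 1 - R))) * pairRecip (s ^ 2) R (n + 1))) := by
  have hq := norm_sq_lt_one hs
  induction R with
  | zero => simp
  | succ r ih =>
    rw [sum_range_succ, ih (by omega)]
    obtain ⟨m, rfl⟩ := Nat.exists_eq_add_of_le (show r ≤ n by omega)
    have h := pairRecip_succ hq r (m + 1)
    have e2 : recip (s ^ 2) (r + m - r) * recip (s ^ 2) (r + m + r + 1) =
        (1 - (s ^ 2) ^ (m + 1)) * pairRecip (s ^ 2) r (r + m + 1) := by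
      rw [Nat.add_sub_cancel_left, add_assoc r m 1, pairRecip_add, ← recip_succ hq m]
      rw [show r + m + r + 1 = 2 * r + (m + 1) by ring]
      ring
    rw [e2, show r + m + 1 - (r + 1) = m by omega, show r + m + 1 - r = m + 1 by omega,
      ← add_two_mul_choose_two r, choose_two_succ]
    rw [← add_assoc r m 1] at h
    linear_combination ((-1) ^ r * s ^ (3 * r.choose 2 + 2 * r) *
      (-s ^ (2 * r + 1) - s ^ (3 * r + 2 * m + 2))) * h

/-- Over the common denominator (q;q)_{n-r} (q;q)_{n+r+1} the numerator is 1 - s^(2n+2r+2) -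
s^(2r+1) + s^(2n+1), which factors as (1 + s^(2n+1)) (1 - s^(2r+1)). -/
theorem sum_pairRecip_eq_mul {s : ℂ} (hs : ‖s‖ < 1) (n : ℕ) :
    ∑ r ∈ range (n + 1), (-1) ^ r * s ^ (r ^ 2 + (r + 1).choose 2) *
      (pairRecip (s ^ 2) r n - s ^ (2 * r + 1) * pairRecip (s ^ 2) (r + 1) n) =
    (1 + s ^ (2 * n + 1)) * ∑ r ∈ range (n + 1), (-1) ^ r * s ^ (r ^ 2 + (r + 1).choose 2) *
      ((1 - s ^ (2 * r + 1)) * (recip (s ^ 2) (n - r) * recip (s ^ 2) (n + r + 1))) := by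
  have hq := norm_sq_lt_one hs
  rw [mul_sum]
  refine sum_congr rfl fun r hr => ?_
  have hrn : r ≤ n := by have := mem_range.1 hr; omega
  obtain ⟨m, rfl⟩ := Nat.exists_eq_add_of_le hrn
  have e1 : pairRecip (s ^ 2) r (r + m) = (1 - (s ^ 2) ^ (2 * r + m + 1)) *
      (recip (s ^ 2) m * recip (s ^ 2) (2 * r + m + 1)) := by
    rw [pairRecip_add, ← recip_succ hq (2 * r + m)]; ring
  have e2 : pairRecip (s ^ 2) (r + 1) (r + m) = (1 - (s ^ 2) ^ m) *
      (recip (s ^ 2) m * recip (s ^ 2) (2 * r + m + 1)) := by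
    cases m with
    | zero => simp [pairRecip_of_lt]
    | succ m =>
      rw [show r + (m + 1) = r + 1 + m by ring, pairRecip_add, ← recip_succ hq m,
        show 2 * (r + 1) + m = 2 * r + (m + 1) + 1 by ring]
      ring
  rw [e1, e2, Nat.add_sub_cancel_left, show r + m + r + 1 = 2 * r + m + 1 by ring]
  ring

/-- The left side does not depend on n: the sum at n is (1 + s^(2n+1)) (1 - s^(4n+4)) times the sum
at n + 1. -/
theorem sum_pairRecip {s : ℂ} (hs : ‖s‖ < 1) (n : ℕ) :
    qPoch (s ^ 4) (s ^ 4) n * qPoch (-s) (s ^ 2) n *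
      ∑ r ∈ range (n + 1), (-1) ^ r * s ^ (r ^ 2 + (r + 1).choose 2) *
      (pairRecip (s ^ 2) r n - s ^ (2 * r + 1) * pairRecip (s ^ 2) (r + 1) n) = 1 := by
  induction n with
  | zero => simp [qPoch_zero, pairRecip, recip_zero]
  | succ n ih =>
    rw [sum_pairRecip_eq_mul hs] at ih
    have h1 := sum_pairRecip_step hs n (n + 1) le_rfl
    have h2 : ∑ r ∈ range (n + 1), (-1) ^ r * s ^ (r ^ 2 + (r + 1).choose 2) *
        ((1 - s ^ (2 * r + 1)) * (recip (s ^ 2) (n - r) * recip (s ^ 2) (n + r + 1))) =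
        (1 - s ^ (4 * n + 4)) *
          ∑ r ∈ range (n + 2), (-1) ^ r * s ^ (r ^ 2 + (r + 1).choose 2) *
            (pairRecip (s ^ 2) r (n + 1) -
              s ^ (2 * r + 1) * pairRecip (s ^ 2) (r + 1) (n + 1)) := by
      -- At R = n + 1 the second half of the telescoped remainder vanishes, and the first is exactly
      -- the new term r = n + 1.
      rw [sum_range_succ _ (n + 1), mul_add, mul_sum, ← sub_eq_iff_eq_add', ← sum_sub_distrib]
      rw [pairRecip_of_lt _ (Nat.lt_succ_self (n + 1)), Nat.sub_self] at *
      rw [← add_two_mul_choose_two (n + 1), choose_two_succ (n + 1)]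
      refine (sum_congr rfl fun r _ => ?_).trans (h1.trans ?_) <;> ring
    rw [h2] at ih
    rw [qPoch_succ, qPoch_succ]
    refine Eq.trans ?_ ih
    ring

/-- Kernels with r > n vanish, so the cutoff R is free; one R can then serve all n ≤ L at once. -/
theorem sum_range_kernel_eq {s : ℂ} (c x y : ℕ → ℂ) {n R : ℕ} (hR : n < R) :
    ∑ r ∈ range R, c r * (x r * kernel s r n - y r * kernel s (r + 1) n) =
      qPoch (-s) (s ^ 2) n * ∑ r ∈ range (n + 1),
        c r * (x r * pairRecip (s ^ 2) r n - y r * pairRecip (s ^ 2) (r + 1) n) := by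
  rw [mul_sum]
  symm
  refine sum_subset_zero_on_sdiff (range_mono hR) ?_ ?_
  · intro r hr
    have : n < r := by simp at hr; omega
    simp [kernel, pairRecip_of_lt _ this, pairRecip_of_lt _ (this.trans (Nat.lt_succ_self r))]
  · intro r _
    simp only [kernel]
    ring

/-- The expansion of `1 / (q ^ 2; q ^ 2)_n` in the kernels. -/
theorem inv_qPoch_eq_sum_kernel {s : ℂ} (hs : ‖s‖ < 1) {n R : ℕ} (hR : n < R) :
    (qPoch (s ^ 4) (s ^ 4) n)⁻¹ = ∑ r ∈ range R, (-1) ^ r * s ^ (r ^ 2 + (r + 1).choose 2) *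
      (kernel s r n - s ^ (2 * r + 1) * kernel s (r + 1) n) := by
  have h := sum_range_kernel_eq (s := s) (fun r => (-1) ^ r * s ^ (r ^ 2 + (r + 1).choose 2))
    (fun _ => 1) (fun r => s ^ (2 * r + 1)) hR
  simp only [one_mul] at h
  rw [h]
  apply inv_eq_of_mul_eq_one_right
  rw [← mul_assoc, sum_pairRecip hs]

/-- The expansion of `q ^ n / (q ^ 2; q ^ 2)_n` in the kernels. -/
theorem pow_mul_inv_qPoch_eq_sum_kernel {s : ℂ} (hs : ‖s‖ < 1) {n R : ℕ} (hR : n < R) :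
    s ^ (2 * n) * (qPoch (s ^ 4) (s ^ 4) n)⁻¹ =
      ∑ r ∈ range R, (-1) ^ r * s ^ (r ^ 2 + (r + 1).choose 2 + r) *
        (kernel s r n - kernel s (r + 1) n) := by
  rw [inv_qPoch_eq_sum_kernel hs hR]
  have h := sum_range_kernel_eq (s := s) (fun r => (-1) ^ r * s ^ (r ^ 2 + (r + 1).choose 2))
    (fun _ => 1) (fun r => s ^ (2 * r + 1)) hR
  have h' := sum_range_kernel_eq (s := s)
    (fun r => (-1) ^ r * s ^ (r ^ 2 + (r + 1).choose 2 + r)) (fun _ => 1) (fun _ => 1) hR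
  simp only [one_mul] at h h'
  rw [h, h', mul_left_comm]
  congr 1
  -- At R = n + 1 the remainder contains `pairRecip` with r = n + 1 > n, which is zero.
  have h2 := sum_pairRecip_sub hs n (n + 1) le_rfl
  rw [pairRecip_of_lt _ (Nat.lt_succ_self n), mul_zero] at h2
  rw [← sub_eq_zero, ← h2, mul_sum, ← sum_sub_distrib]
  exact sum_congr rfl fun r _ => by ring

/-! ### Iterating the transform -/

/-- The weight `q ^ (N ^ 2 / 2)`, or `q ^ (N ^ 2 / 2 + N)` if `i = 1`. -/
noncomputable def weight (s : ℂ) (i N : ℕ) : ℂ := s ^ (N ^ 2 + if i = 1 then 2 * N else 0)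

/-- The index that plays the role of `i` once the first summation variable is removed. -/
def nextIndex (i : ℕ) : ℕ := if i = 1 then 2 else i - 1

/-- The iterated Bailey transform of `1 / (q ^ 2; q ^ 2)_n`. -/
noncomputable def bailey (s : ℂ) : ℕ → ℕ → ℕ → ℂ
  | 0, _, n => (qPoch (s ^ 4) (s ^ 4) n)⁻¹
  | k + 1, i, n => ∑ p ∈ antidiagonal n,
      recip (s ^ 2) p.1 * (weight s i p.2 * bailey s k (nextIndex i) p.2)

theorem sum_kernel_comb {s : ℂ} (hs : ‖s‖ < 1) (g : ℕ → ℂ) (c x y : ℕ → ℂ) {L R : ℕ}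
    (h : ∀ n ≤ L, g n = ∑ r ∈ range R, c r * (x r * kernel s r n - y r * kernel s (r + 1) n)) :
    ∑ p ∈ antidiagonal L, recip (s ^ 2) p.1 * (s ^ (p.2 ^ 2) * g p.2) =
      ∑ r ∈ range R, c r * (x r * s ^ (r ^ 2) * kernel s r L -
        y r * s ^ ((r + 1) ^ 2) * kernel s (r + 1) L) := by
  simp only [mul_assoc (x _), mul_assoc (y _), ← sum_kernel hs]
  simp only [mul_sum, ← sum_sub_distrib]
  rw [sum_comm]
  refine sum_congr rfl fun p hp => ?_
  have := HasAntidiagonal.mem_antidiagonal.1 hp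
  rw [h p.2 (by omega)]
  simp only [mul_sum]
  exact sum_congr rfl fun r _ => by ring

/-- The expansion of the iterated Bailey transform in the kernels. -/
theorem bailey_eq_sum_kernel {s : ℂ} (hs : ‖s‖ < 1) (k : ℕ) :
    ∀ d j n R : ℕ, d + j = k → n < R → bailey s k (j + 1) n =
      ∑ r ∈ range R, (-1) ^ r * s ^ (d * (r * (r + 1)) + (r + 1).choose 2 + (j + 1) * r ^ 2) *
        (kernel s r n - s ^ ((2 * r + 1) * (j + 1)) * kernel s (r + 1) n) := by
  induction k using Nat.strong_induction_on with
  | _ k ih =>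
  intro d j n R hk hR
  rcases j with _ | j
  · rcases d with _ | _ | d
    · subst hk
      rw [bailey, inv_qPoch_eq_sum_kernel hs hR]
      exact sum_congr rfl fun r _ => by ring
    -- The formula at index 2 would need d = -1 here, so the expansion of q^n times the seed
    -- replaces it.
    · subst hk
      have h := sum_kernel_comb hs (fun n => s ^ (2 * n) * (qPoch (s ^ 4) (s ^ 4) n)⁻¹)
        (fun r => (-1) ^ r * s ^ (r ^ 2 + (r + 1).choose 2 + r)) (fun _ => 1) (fun _ => 1)
        (L := n) (R := R) fun m hm => by
          rw [pow_mul_inv_qPoch_eq_sum_kernel hs (hm.trans_lt hR)]; simp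
      simp only [bailey, weight, if_true, zero_add, pow_add, mul_assoc] at h ⊢
      rw [h]
      exact sum_congr rfl fun r _ => by ring
    · subst hk
      have h := sum_kernel_comb hs (fun n => s ^ (2 * n) * bailey s (d + 1) 2 n)
        (fun r => (-1) ^ r * s ^ (d * (r * (r + 1)) + (r + 1).choose 2 + 2 * r ^ 2 + 2 * r))
        (fun _ => 1) (fun _ => 1) (L := n) (R := R) fun m hm => by
          rw [ih (d + 1) (by omega) d 1 m R rfl (hm.trans_lt hR), mul_sum]
          refine sum_congr rfl fun r _ => ?_
          have := kernel_mul_pow hs r m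
          linear_combination
            ((-1) ^ r * s ^ (d * (r * (r + 1)) + (r + 1).choose 2 + 2 * r ^ 2)) * this
      have e : nextIndex (0 + 1) = 2 := rfl
      rw [show d + 1 + 1 + 0 = d + 1 + 1 from rfl, bailey, e]
      simp only [weight, if_true, zero_add, pow_add, mul_assoc] at h ⊢
      rw [h]
      exact sum_congr rfl fun r _ => by ring
  · obtain rfl : k = d + j + 1 := by omega
    have h := sum_kernel_comb hs (bailey s (d + j) (j + 1))
      (fun r => (-1) ^ r * s ^ (d * (r * (r + 1)) + (r + 1).choose 2 + (j + 1) * r ^ 2))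
      (fun _ => 1) (fun r => s ^ ((2 * r + 1) * (j + 1))) (L := n) (R := R) fun m hm => by
        rw [ih (d + j) (by omega) d j m R rfl (hm.trans_lt hR)]; simp
    have e : nextIndex (j + 1 + 1) = j + 1 := by simp [nextIndex]
    rw [bailey, e]
    simp only [weight, show j + 1 + 1 ≠ 1 by omega, if_false, add_zero]
    rw [h]
    exact sum_congr rfl fun r _ => by ring

/-! ### Limits and uniform bounds -/

theorem tendsto_qPoch (a : ℂ) {q : ℂ} (hq : ‖q‖ < 1) :
    Tendsto (qPoch a q) atTop (𝓝 (qPochInf a q)) :=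
  (multipliable_qPochInf a q hq).hasProd.tendsto_prod_nat

theorem qPochInf_self_ne_zero {q : ℂ} (hq : ‖q‖ < 1) : qPochInf q q ≠ 0 := by
  have h := tprod_one_add_ne_zero_of_summable (f := fun n : ℕ => -(q * q ^ n)) (fun n => by
      rw [← sub_eq_add_neg, ← pow_succ']; exact one_sub_pow_ne_zero hq n) (by
      simp only [norm_neg, norm_mul, norm_pow]
      exact (summable_geometric_of_lt_one (norm_nonneg q) hq).mul_left _)
  simpa [qPochInf, sub_eq_add_neg] using h

theorem tendsto_recip {q : ℂ} (hq : ‖q‖ < 1) :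
    Tendsto (recip q) atTop (𝓝 (qPochInf q q)⁻¹) :=
  (tendsto_qPoch q hq).inv₀ (qPochInf_self_ne_zero hq)

theorem exists_norm_le_of_tendsto {f : ℕ → ℂ} {a : ℂ} (h : Tendsto f atTop (𝓝 a)) :
    ∃ C : ℝ, 0 ≤ C ∧ ∀ n, ‖f n‖ ≤ C := by
  obtain ⟨C, hC⟩ := (Metric.isBounded_range_of_tendsto f h).exists_norm_le
  exact ⟨C, (norm_nonneg _).trans (hC _ ⟨0, rfl⟩), fun n => hC _ ⟨n, rfl⟩⟩

theorem exists_norm_pairRecip_le {q : ℂ} (hq : ‖q‖ < 1) :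
    ∃ C : ℝ, 0 ≤ C ∧ ∀ r n, ‖pairRecip q r n‖ ≤ C := by
  obtain ⟨C, h0, hC⟩ := exists_norm_le_of_tendsto (tendsto_recip hq)
  refine ⟨C * C, by positivity, fun r n => ?_⟩
  rw [pairRecip]
  split_ifs
  · rw [norm_mul]
    exact mul_le_mul (hC _) (hC _) (norm_nonneg _) h0
  · rw [norm_zero]; positivity

theorem tendsto_pairRecip {q : ℂ} (hq : ‖q‖ < 1) (r : ℕ) :
    Tendsto (pairRecip q r) atTop (𝓝 ((qPochInf q q)⁻¹ * (qPochInf q q)⁻¹)) := by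
  have h := ((tendsto_recip hq).comp (tendsto_sub_atTop_nat r)).mul
    ((tendsto_recip hq).comp (tendsto_add_atTop_nat r))
  refine h.congr' ?_
  filter_upwards [eventually_ge_atTop r] with n hn
  simp [pairRecip, hn]

/-- Tannery's theorem for sums over initial segments. -/
theorem tendsto_sum_range_of_dominated {f : ℕ → ℕ → ℂ} {g : ℕ → ℂ} {bound : ℕ → ℝ}
    (hb : Summable bound) (hf : ∀ r, Tendsto (f · r) atTop (𝓝 (g r)))
    (hle : ∀ n r, ‖f n r‖ ≤ bound r) :
    Tendsto (fun n => ∑ r ∈ range (n + 1), f n r) atTop (𝓝 (∑' r, g r)) := by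
  have h := tendsto_tsum_of_dominated_convergence
    (f := fun n r => if r < n + 1 then f n r else 0) (g := g) (𝓕 := atTop) hb
    (fun r => (hf r).congr' (by
      filter_upwards [eventually_ge_atTop r] with n hn
      rw [if_pos (by omega)]))
    (Eventually.of_forall fun n r => by
      split_ifs
      · exact hle n r
      · rw [norm_zero]; exact (norm_nonneg _).trans (hle n r))
  refine h.congr fun n => ?_
  rw [tsum_eq_sum (s := range (n + 1)) (fun r hr => if_neg (by simpa using hr))]
  exact sum_congr rfl fun r hr => if_pos (by simpa using hr)

/-! ### The Jacobi triple product -/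

/-- The terms `x ^ r * (x * y) ^ (r * (r - 1) / 2)` of the theta series, with the negative powers
of `x` absorbed into `x * y`. -/
noncomputable def thetaTerm (x y : ℂ) : ℤ → ℂ
  | Int.ofNat n => x ^ n * (x * y) ^ (n.choose 2)
  | Int.negSucc n => y ^ (n + 1) * (x * y) ^ ((n + 1).choose 2)

theorem thetaTerm_natCast (x y : ℂ) (n : ℕ) :
    thetaTerm x y n = x ^ n * (x * y) ^ (n.choose 2) := rfl

theorem thetaTerm_neg (x y : ℂ) (r : ℤ) : thetaTerm x y (-r) = thetaTerm y x r := by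
  rcases r with (_ | n) | n
  · simp [thetaTerm]
  · change y ^ (n + 1) * (x * y) ^ ((n + 1).choose 2) = y ^ (n + 1) * (y * x) ^ ((n + 1).choose 2)
    rw [mul_comm x y]
  · rw [Int.neg_negSucc]
    simp only [thetaTerm]
    rw [mul_comm x y]

theorem thetaTerm_neg_natCast (x y : ℂ) (n : ℕ) :
    thetaTerm x y (-n) = y ^ n * (x * y) ^ (n.choose 2) := by
  rw [thetaTerm_neg, thetaTerm_natCast, mul_comm x y]

/-- The recurrence θ(r+1) = x (xy)^r θ(r), with (xy)^c clearing negative powers, so that x and y may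
be 0. -/
theorem thetaTerm_succ (x y : ℂ) (r : ℤ) (c m : ℕ) (h : c + r = m) :
    (x * y) ^ c * thetaTerm x y (r + 1) = x * (x * y) ^ m * thetaTerm x y r := by
  obtain ⟨n, rfl | rfl⟩ := Int.eq_nat_or_neg r
  · have : m = c + n := by omega
    rw [this, show (n : ℤ) + 1 = (n + 1 : ℕ) by push_cast; ring, thetaTerm_natCast,
      thetaTerm_natCast, choose_two_succ]
    ring
  · rcases n with _ | n
    · have : m = c := by omega
      rw [this]
      simp [thetaTerm, show (0 : ℤ) + 1 = (1 : ℕ) by rfl]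
      ring
    · have : c = m + n + 1 := by omega
      rw [this, show -((n + 1 : ℕ) : ℤ) + 1 = -(n : ℤ) by push_cast; ring,
        thetaTerm_neg_natCast, thetaTerm_neg_natCast, choose_two_succ]
      ring

/-- A finite form of the Jacobi triple product identity. -/
theorem sum_thetaTerm {x y : ℂ} (h : ‖x * y‖ < 1) (m n : ℕ) :
    ∑ p ∈ antidiagonal (m + n), recip (x * y) p.1 * recip (x * y) p.2 *
        thetaTerm x y (p.1 - n) =
      recip (x * y) (m + n) * (qPoch (-x) (x * y) m * qPoch (-y) (x * y) n) := by
  induction m with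
  | zero =>
    induction n with
    | zero => simp [recip_zero, qPoch_zero, thetaTerm]
    | succ n ih =>
      rw [zero_add] at ih ⊢
      apply mul_left_cancel₀ (one_sub_pow_ne_zero h n)
      rw [sum_pascal' h n fun a _ => thetaTerm x y (a - (n + 1 : ℕ)), ← mul_assoc,
        recip_succ h, qPoch_succ _ _ n]
      trans (1 + y * (x * y) ^ n) * (recip (x * y) n * (qPoch (-x) (x * y) 0 *
        qPoch (-y) (x * y) n))
      · rw [← ih, mul_sum]
        refine sum_congr rfl fun p _ => ?_
        have h1 := thetaTerm_succ y x (-(p.1 - n : ℤ)) p.1 n (by ring)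
        rw [thetaTerm_neg, show -((p.1 : ℤ) - n) + 1 = -(p.1 - (n + 1 : ℕ)) by push_cast; ring,
          thetaTerm_neg, mul_comm y x] at h1
        rw [h1, show ((p.1 + 1 : ℕ) : ℤ) - (n + 1 : ℕ) = p.1 - n by push_cast; ring]
        ring
      · ring
  | succ m ih =>
    rw [show m + 1 + n = m + n + 1 by ring]
    apply mul_left_cancel₀ (one_sub_pow_ne_zero h (m + n))
    rw [sum_pascal h (m + n) fun a _ => thetaTerm x y (a - n), ← mul_assoc,
      recip_succ h, qPoch_succ _ _ m]
    trans (1 + x * (x * y) ^ m) * (recip (x * y) (m + n) * (qPoch (-x) (x * y) m *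
      qPoch (-y) (x * y) n))
    · rw [← ih, mul_sum]
      refine sum_congr rfl fun p hp => ?_
      have hp' := HasAntidiagonal.mem_antidiagonal.1 hp
      have h1 := thetaTerm_succ x y (p.1 - n : ℤ) p.2 m (by omega)
      rw [show ((p.1 + 1 : ℕ) : ℤ) - n = p.1 - n + 1 by push_cast; ring, h1]
      ring
    · ring

theorem sum_thetaTerm_fold (x y q : ℂ) (n : ℕ) :
    ∑ p ∈ antidiagonal (n + n), recip q p.1 * recip q p.2 * thetaTerm x y (p.1 - n) =
      ∑ r ∈ range (n + 1), (pairRecip q r n * thetaTerm x y r +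
        pairRecip q (r + 1) n * thetaTerm x y (-(r + 1 : ℕ))) := by
  rw [Finset.Nat.sum_antidiagonal_eq_sum_range_succ_mk, Nat.succ_eq_add_one, add_assoc n n 1,
    sum_range_add, sum_add_distrib, add_comm]
  congr 1
  · refine sum_congr rfl fun r hr => ?_
    have : r ≤ n := by have := mem_range.1 hr; omega
    rw [pairRecip, if_pos this, show n + n - (n + r) = n - r by omega,
      show ((n + r : ℕ) : ℤ) - n = r by push_cast; ring]
    ring
  -- The negative half has only n terms; the extra one at r = n is zero and makes the ranges agree.
  · rw [sum_range_succ, pairRecip_of_lt _ (Nat.lt_succ_self n), zero_mul, add_zero,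
      ← sum_range_reflect]
    refine sum_congr rfl fun r hr => ?_
    have : r < n := mem_range.1 hr
    rw [pairRecip, if_pos (by omega), show n + n - (n - 1 - r) = n + (r + 1) by omega,
      show n - 1 - r = n - (r + 1) by omega,
      show ((n - (r + 1) : ℕ) : ℤ) - n = -(r + 1 : ℕ) by omega]

theorem norm_thetaTerm_le {x y : ℂ} (hx : ‖x‖ < 1) (hy : ‖y‖ < 1) (n : ℕ) :
    ‖thetaTerm x y n‖ ≤ ‖x‖ ^ n := by
  rw [thetaTerm_natCast, norm_mul, norm_pow, norm_pow, norm_mul]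
  exact mul_le_of_le_one_right (by positivity)
    (pow_le_one₀ (by positivity) (mul_le_one₀ hx.le (norm_nonneg _) hy.le))

/-- The Jacobi triple product identity. -/
theorem tsum_thetaTerm {x y : ℂ} (hx : ‖x‖ < 1) (hy : ‖y‖ < 1) :
    ∑' r : ℕ, (thetaTerm x y r + thetaTerm x y (-(r + 1 : ℕ))) =
      qPochInf (-x) (x * y) * qPochInf (-y) (x * y) * qPochInf (x * y) (x * y) := by
  have h : ‖x * y‖ < 1 := by
    rw [norm_mul]; exact mul_lt_one_of_nonneg_of_lt_one_left (norm_nonneg _) hx hy.le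
  obtain ⟨C, hC0, hC⟩ := exists_norm_pairRecip_le h
  have hne := qPochInf_self_ne_zero h
  have h1 := tendsto_sum_range_of_dominated
    (f := fun n r => pairRecip (x * y) r n * thetaTerm x y r +
        pairRecip (x * y) (r + 1) n * thetaTerm x y (-(r + 1 : ℕ)))
    (bound := fun r => C * ‖x‖ ^ r + C * (‖y‖ ^ r * ‖y‖))
    (((summable_geometric_of_lt_one (norm_nonneg x) hx).mul_left C).add
      (((summable_geometric_of_lt_one (norm_nonneg y) hy).mul_right _).mul_left C))
    (fun r => ((tendsto_pairRecip h r).mul_const _).add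
      ((tendsto_pairRecip h (r + 1)).mul_const _))
    (fun n r => by
      refine (norm_add_le _ _).trans (add_le_add ?_ ?_)
      · rw [norm_mul]
        exact mul_le_mul (hC _ _) (norm_thetaTerm_le hx hy _) (norm_nonneg _) hC0
      · rw [norm_mul, thetaTerm_neg, ← pow_succ]
        exact mul_le_mul (hC _ _) (norm_thetaTerm_le hy hx _) (norm_nonneg _) hC0)
  simp only [← mul_add] at h1
  rw [tsum_mul_left] at h1
  have h2 : Tendsto (fun n => recip (x * y) (n + n) *
      (qPoch (-x) (x * y) n * qPoch (-y) (x * y) n)) atTop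
      (𝓝 ((qPochInf (x * y) (x * y))⁻¹ *
        (qPochInf (-x) (x * y) * qPochInf (-y) (x * y)))) :=
    ((tendsto_recip h).comp (tendsto_atTop_mono (fun n => Nat.le_add_right n n)
      tendsto_id)).mul ((tendsto_qPoch _ h).mul (tendsto_qPoch _ h))
  have h3 := tendsto_nhds_unique (h1.congr fun n => by
    rw [← sum_thetaTerm h n n, sum_thetaTerm_fold]) h2
  field_simp at h3
  rw [h3]
  ring

/-! ### Peeling variables off the multiple series -/

theorem sum_Icc_one_eq_sum_range (f : ℕ → ℕ) (k : ℕ) :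
    ∑ l ∈ Icc 1 k, f l = ∑ l ∈ range k, f (l + 1) := by
  rw [range_eq_Ico, sum_Ico_add' f 0 k 1]
  rfl

theorem tailSum_one {k : ℕ} (n : Fin k → ℕ) : tailSum n 1 = ∑ j, n j := by
  simp [tailSum]

theorem tailSum_cons {k : ℕ} (a : ℕ) (n : Fin k → ℕ) (l : ℕ) :
    tailSum (Fin.cons a n : Fin (k + 1) → ℕ) (l + 2) = tailSum n (l + 1) := by
  simp [tailSum, sum_filter, Fin.sum_univ_succ]

theorem sqSum_cons {k : ℕ} (a : ℕ) (n : Fin k → ℕ) :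
    sqSum (Fin.cons a n : Fin (k + 1) → ℕ) = (a + ∑ j, n j) ^ 2 + sqSum n := by
  rw [sqSum, sqSum, sum_Icc_one_eq_sum_range, sum_Icc_one_eq_sum_range, sum_range_succ', add_comm]
  simp only [zero_add, tailSum_one, tailSum_cons, Fin.sum_cons, add_assoc, Nat.reduceAdd]

theorem altSum_eq_sum_range {k i : ℕ} (hi : 1 ≤ i) (n : Fin k → ℕ) :
    altSum i n = ∑ l ∈ range k,
      if i ≤ l + 1 ∧ (l + 1) % 2 = i % 2 then tailSum n (l + 1) else 0 := by
  rw [← sum_Icc_one_eq_sum_range fun l => if i ≤ l ∧ l % 2 = i % 2 then tailSum n l else 0,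
    ← sum_filter, altSum]
  refine sum_congr ?_ fun _ _ => rfl
  ext l
  simp only [mem_filter, mem_Icc]
  omega

theorem altSum_one_cons {k : ℕ} (a : ℕ) (n : Fin k → ℕ) :
    altSum 1 (Fin.cons a n : Fin (k + 1) → ℕ) = (a + ∑ j, n j) + altSum 2 n := by
  rw [altSum_eq_sum_range le_rfl, altSum_eq_sum_range one_le_two, sum_range_succ', add_comm]
  congr 1
  · simp [tailSum_one, Fin.sum_cons]
  · refine sum_congr rfl fun l _ => ?_
    rw [add_assoc l 1 1, tailSum_cons]
    exact if_congr (by omega) rfl rfl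

theorem altSum_succ_cons {k i : ℕ} (hi : 1 ≤ i) (a : ℕ) (n : Fin k → ℕ) :
    altSum (i + 1) (Fin.cons a n : Fin (k + 1) → ℕ) = altSum i n := by
  rw [altSum_eq_sum_range (by omega), altSum_eq_sum_range hi, sum_range_succ',
    if_neg (by omega), add_zero]
  refine sum_congr rfl fun l _ => ?_
  rw [add_assoc l 1 1, tailSum_cons]
  exact if_congr (by omega) rfl rfl

theorem denom_cons {k : ℕ} (q : ℂ) (a : ℕ) (n : Fin (k + 1) → ℕ) :
    denom q (Fin.cons a n : Fin (k + 2) → ℕ) = qPoch q q a * denom q n := by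
  simp [denom, Fin.prod_univ_succ (n := k + 1)]

/-- Prepending a variable turns N_l into N_{l+1}. If i = 1, the new N_1 is split off into the weight
and N_3 + N_5 + ⋯ becomes N_2 + N_4 + ⋯ of the shorter tuple; hence `nextIndex 1 = 2`. -/
theorem pow_sqSum_altSum_cons {k i : ℕ} (hi : 1 ≤ i) (s : ℂ) (a : ℕ) (n : Fin k → ℕ) :
    s ^ (sqSum (Fin.cons a n : Fin (k + 1) → ℕ) +
        2 * altSum i (Fin.cons a n : Fin (k + 1) → ℕ)) =
      weight s i (a + ∑ j, n j) * s ^ (sqSum n + 2 * altSum (nextIndex i) n) := by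
  rw [weight, ← pow_add, sqSum_cons]
  congr 1
  rcases eq_or_lt_of_le hi with rfl | h
  · rw [altSum_one_cons, if_pos rfl, nextIndex, if_pos rfl]
    ring
  · obtain ⟨j, rfl⟩ : ∃ j, i = j + 1 := ⟨i - 1, by omega⟩
    rw [altSum_succ_cons (by omega), if_neg (by omega), nextIndex, if_neg (by omega),
      Nat.add_sub_cancel]
    ring

/-- The general term of the multiple series. -/
noncomputable def term {k : ℕ} (s : ℂ) (i : ℕ) (n : Fin k → ℕ) : ℂ :=
  s ^ (sqSum n + 2 * altSum i n) / denom (s ^ 2) n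

theorem term_cons {k i : ℕ} (hi : 1 ≤ i) (s : ℂ) (a : ℕ) (n : Fin (k + 1) → ℕ) :
    term s i (Fin.cons a n : Fin (k + 2) → ℕ) =
      weight s i (a + ∑ j, n j) * (recip (s ^ 2) a * term s (nextIndex i) n) := by
  rw [term, pow_sqSum_altSum_cons hi, denom_cons, term, recip]
  field_simp

theorem term_singleton {i : ℕ} (hi : 1 ≤ i) (s : ℂ) (N : ℕ) :
    term s i ![N] = weight s i N * (qPoch (s ^ 4) (s ^ 4) N)⁻¹ := by
  have h := pow_sqSum_altSum_cons hi s N ![]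
  have e : (![N] : Fin 1 → ℕ) = Fin.cons N ![] := rfl
  rw [term, e, h]
  have h4 : (s ^ 2) ^ 2 = s ^ 4 := by ring
  simp [sqSum, altSum, tailSum, denom, h4, div_eq_mul_inv]

theorem sum_antidiagonalTuple_succ (k N : ℕ) (f : (Fin (k + 1) → ℕ) → ℂ) :
    ∑ n ∈ Finset.Nat.antidiagonalTuple (k + 1) N, f n =
      ∑ p ∈ antidiagonal N, ∑ n ∈ Finset.Nat.antidiagonalTuple k p.2, f (Fin.cons p.1 n) := by
  rw [sum_sigma']
  symm
  refine sum_bij (fun x _ => Fin.cons x.1.1 x.2) ?_ ?_ ?_ ?_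
  · rintro ⟨p, n⟩ h
    simp only [mem_sigma, HasAntidiagonal.mem_antidiagonal,
      Finset.Nat.mem_antidiagonalTuple] at h ⊢
    rw [Fin.sum_cons, h.2, h.1]
  · rintro ⟨⟨a, b⟩, n⟩ h ⟨⟨a', b'⟩, n'⟩ h' he
    simp only [mem_sigma, HasAntidiagonal.mem_antidiagonal,
      Finset.Nat.mem_antidiagonalTuple] at h h'
    obtain ⟨ha, hn⟩ := Fin.cons_inj.1 he
    simp only at ha hn
    subst ha hn
    obtain rfl : b = b' := by omega
    rfl
  · intro n h
    refine ⟨⟨(n 0, ∑ j, Fin.tail n j), Fin.tail n⟩, ?_, Fin.cons_self_tail n⟩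
    simp only [mem_sigma, HasAntidiagonal.mem_antidiagonal,
      Finset.Nat.mem_antidiagonalTuple, and_true] at h ⊢
    rw [← h, Fin.sum_univ_succ]
    rfl
  · intros; rfl

theorem sum_antidiagonalTuple_term (s : ℂ) (k : ℕ) : ∀ (i : ℕ), 1 ≤ i → ∀ N : ℕ,
    ∑ n ∈ Finset.Nat.antidiagonalTuple (k + 1) N, term s i n =
      weight s i N * bailey s k (nextIndex i) N := by
  induction k with
  | zero =>
    intro i hi N
    rw [Finset.Nat.antidiagonalTuple_one, sum_singleton, term_singleton hi, bailey]
  | succ k ih =>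
    intro i hi N
    have hi' : 1 ≤ nextIndex i := by rw [nextIndex]; split_ifs <;> omega
    rw [sum_antidiagonalTuple_succ, bailey, mul_sum]
    refine sum_congr rfl fun p hp => ?_
    rw [← ih (nextIndex i) hi' p.2, mul_sum, mul_sum]
    refine sum_congr rfl fun n hn => ?_
    rw [term_cons hi, Finset.Nat.mem_antidiagonalTuple.1 hn,
      HasAntidiagonal.mem_antidiagonal.1 hp]

/-! ### Absolute convergence and regrouping by N_1 -/

theorem summable_prod_fin {g : ℕ → ℝ} (hg : Summable g) (h0 : ∀ n, 0 ≤ g n) (k : ℕ) :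
    Summable fun n : Fin k → ℕ => ∏ j, g (n j) := by
  induction k with
  | zero => exact Summable.of_finite
  | succ k ih =>
    rw [← (Fin.consEquiv fun _ : Fin (k + 1) => ℕ).summable_iff]
    have := hg.mul_of_nonneg ih h0 fun n => prod_nonneg fun j _ => h0 _
    refine this.congr fun x => ?_
    simp [Fin.consEquiv, Fin.prod_univ_succ]

theorem sum_le_sqSum {k : ℕ} (n : Fin (k + 1) → ℕ) : ∑ j, n j ≤ sqSum n := by
  rw [sqSum, sum_Icc_one_eq_sum_range, sum_range_succ', zero_add, tailSum_one]
  exact (Nat.le_self_pow two_ne_zero _).trans (Nat.le_add_left _ _)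

/-- The reciprocal factorials are bounded, and the exponent is at least N_1^2 ≥ N_1, so a product of
geometric series dominates. -/
theorem summable_norm_term {s : ℂ} (hs : ‖s‖ < 1) (k i : ℕ) :
    Summable fun n : Fin (k + 1) → ℕ => ‖term s i n‖ := by
  obtain ⟨C₁, h1, hC₁⟩ := exists_norm_le_of_tendsto (tendsto_recip (norm_sq_lt_one hs))
  obtain ⟨C₂, h2, hC₂⟩ := exists_norm_le_of_tendsto
    (tendsto_recip (norm_sq_lt_one (norm_sq_lt_one hs)))
  have hb := summable_prod_fin (g := fun n => (C₁ + C₂) * ‖s‖ ^ n)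
    ((summable_geometric_of_lt_one (norm_nonneg s) hs).mul_left _)
    (fun n => by positivity) (k + 1)
  refine hb.of_nonneg_of_le (fun _ => norm_nonneg _) fun n => ?_
  rw [term, div_eq_mul_inv, norm_mul, norm_pow, prod_mul_distrib, prod_pow_eq_pow_sum, mul_comm,
    denom, ← prod_inv_distrib, norm_prod]
  refine mul_le_mul ?_ ?_ (by positivity) (by positivity)
  · refine prod_le_prod (fun _ _ => norm_nonneg _) fun j _ => ?_
    split_ifs
    · exact (hC₂ (n j)).trans (by linarith)
    · exact (hC₁ (n j)).trans (by linarith)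
  · exact pow_le_pow_of_le_one (norm_nonneg _) hs.le
      ((sum_le_sqSum n).trans (Nat.le_add_right _ _))

theorem hasSum_tsum_fiber {α : Type*} {f : α → ℂ} (hf : Summable fun a => ‖f a‖) (φ : α → ℕ)
    (F : ℕ → Finset α) (hF : ∀ N a, a ∈ F N ↔ φ a = N) :
    Summable (fun N => ‖∑ a ∈ F N, f a‖) ∧ HasSum f (∑' N, ∑ a ∈ F N, f a) := by
  have hfib : ∀ N, HasSum (fun a : {a // φ a = N} => f a) (∑ a ∈ F N, f a) := fun N => by
    have h := Finset.hasSum (F N) f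
    exact (Equiv.subtypeEquivRight (hF N)).hasSum_iff.1 h
  have h1 : Summable fun x : Σ N, {a // φ a = N} => ‖f x.2‖ :=
    (Equiv.sigmaFiberEquiv φ).summable_iff.2 hf
  have h2 : HasSum (fun x : Σ N, {a // φ a = N} => f x.2) (∑' a, f a) :=
    (Equiv.sigmaFiberEquiv φ).hasSum_iff.2 hf.of_norm.hasSum
  constructor
  · refine h1.sigma.of_nonneg_of_le (fun _ => norm_nonneg _) fun N => ?_
    rw [← (hfib N).tsum_eq]
    exact norm_tsum_le_tsum_norm (h1.sigma_factor N)
  · rw [(h2.sigma hfib).tsum_eq]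
    exact hf.of_norm.hasSum

/-- The multiple series, summed over the tuples with a given sum first. -/
theorem hasSum_term {s : ℂ} (hs : ‖s‖ < 1) {k i : ℕ} (hi : 1 ≤ i) :
    Summable (fun N => ‖weight s i N * bailey s k (nextIndex i) N‖) ∧
    HasSum (fun n : Fin (k + 1) → ℕ => term s i n)
      (∑' N, weight s i N * bailey s k (nextIndex i) N) := by
  have h := hasSum_tsum_fiber (summable_norm_term hs k i) (fun n => ∑ j, n j)
    (Finset.Nat.antidiagonalTuple (k + 1)) fun N n => Finset.Nat.mem_antidiagonalTuple
  simpa only [sum_antidiagonalTuple_term s k i hi] using h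

/-- In one further transform, 1/(q;q)_{L-N} tends boundedly to 1/(q;q)_∞, so the limit is the
multiple series up to this factor. -/
theorem tendsto_bailey_of_summable {s : ℂ} (hs : ‖s‖ < 1) {k i : ℕ}
    (h : Summable fun N => ‖weight s i N * bailey s k (nextIndex i) N‖) :
    Tendsto (bailey s (k + 1) i) atTop (𝓝 ((qPochInf (s ^ 2) (s ^ 2))⁻¹ *
      ∑' N, weight s i N * bailey s k (nextIndex i) N)) := by
  have hr := tendsto_recip (norm_sq_lt_one hs)
  obtain ⟨C, hC0, hC⟩ := exists_norm_le_of_tendsto hr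
  rw [← tsum_mul_left]
  have h1 := tendsto_sum_range_of_dominated
    (f := fun L N => recip (s ^ 2) (L - N) * (weight s i N * bailey s k (nextIndex i) N))
    (h.mul_left C) (fun N => (hr.comp (tendsto_sub_atTop_nat N)).mul_const _)
    (fun L N => by
      rw [norm_mul]
      exact mul_le_mul_of_nonneg_right (hC _) (norm_nonneg _))
  refine h1.congr fun L => ?_
  rw [bailey, ← Finset.Nat.sum_antidiagonal_swap,
    Finset.Nat.sum_antidiagonal_eq_sum_range_succ_mk]
  rfl

/-! ### The limit as a theta product -/

theorem tendsto_kernel {s : ℂ} (hs : ‖s‖ < 1) (r : ℕ) :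
    Tendsto (kernel s r) atTop (𝓝 (qPochInf (-s) (s ^ 2) *
      ((qPochInf (s ^ 2) (s ^ 2))⁻¹ * (qPochInf (s ^ 2) (s ^ 2))⁻¹))) :=
  (tendsto_qPoch _ (norm_sq_lt_one hs)).mul (tendsto_pairRecip (norm_sq_lt_one hs) r)

theorem exists_norm_kernel_le {s : ℂ} (hs : ‖s‖ < 1) :
    ∃ C : ℝ, 0 ≤ C ∧ ∀ r n, ‖kernel s r n‖ ≤ C := by
  obtain ⟨C₁, h1, hC₁⟩ := exists_norm_le_of_tendsto (tendsto_qPoch (-s) (norm_sq_lt_one hs))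
  obtain ⟨C₂, h2, hC₂⟩ := exists_norm_pairRecip_le (norm_sq_lt_one hs)
  refine ⟨C₁ * C₂, by positivity, fun r n => ?_⟩
  rw [kernel, norm_mul]
  exact mul_le_mul (hC₁ _) (hC₂ _ _) (norm_nonneg _) h1

theorem norm_pow_lt_one {s : ℂ} (hs : ‖s‖ < 1) (m : ℕ) : ‖s ^ (m + 1)‖ < 1 := by
  rw [norm_pow]; exact pow_lt_one₀ (norm_nonneg _) hs (Nat.succ_ne_zero m)

theorem tendsto_bailey {s : ℂ} (hs : ‖s‖ < 1) (d j : ℕ) :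
    Tendsto (bailey s (d + j) (j + 1)) atTop (𝓝 (qPochInf (-s) (s ^ 2) *
      ((qPochInf (s ^ 2) (s ^ 2))⁻¹ * (qPochInf (s ^ 2) (s ^ 2))⁻¹) *
      (qPochInf (s ^ (2 * d + j + 2)) (s ^ (2 * d + 2 * j + 3)) *
        qPochInf (s ^ (j + 1)) (s ^ (2 * d + 2 * j + 3)) *
        qPochInf (s ^ (2 * d + 2 * j + 3)) (s ^ (2 * d + 2 * j + 3))))) := by
  obtain ⟨C, hC0, hC⟩ := exists_norm_kernel_le hs
  have h1 := tendsto_sum_range_of_dominated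
    (f := fun n r =>
      (-1) ^ r * s ^ (d * (r * (r + 1)) + (r + 1).choose 2 + (j + 1) * r ^ 2) *
        (kernel s r n - s ^ ((2 * r + 1) * (j + 1)) * kernel s (r + 1) n))
    (bound := fun r => ‖s‖ ^ r * (C + C))
    ((summable_geometric_of_lt_one (norm_nonneg s) hs).mul_right _)
    (fun r => (((tendsto_kernel hs r).sub ((tendsto_kernel hs (r + 1)).const_mul _)).const_mul _))
    (fun n r => by
      rw [norm_mul, norm_mul, norm_pow, norm_neg, norm_one, one_pow, one_mul, norm_pow]
      refine mul_le_mul ?_ ((norm_sub_le _ _).trans (add_le_add (hC _ _) ?_))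
        (norm_nonneg _) (by positivity)
      · refine pow_le_pow_of_le_one (norm_nonneg _) hs.le ?_
        -- The exponent is at least (j + 1) r^2 ≥ r.
        nlinarith [Nat.le_self_pow two_ne_zero r, Nat.zero_le (d * (r * (r + 1))),
          Nat.zero_le (j * r ^ 2), Nat.zero_le ((r + 1).choose 2)]
      · rw [norm_mul, norm_pow]
        exact (mul_le_of_le_one_left (norm_nonneg _)
          (pow_le_one₀ (norm_nonneg _) hs.le)).trans (hC _ _))
  -- The signs of x and y give (-1)^r in θ(r) and (-1)^(r+1) in θ(-r-1), matching the two parts of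
  -- the r-th term.
  have h2 := tsum_thetaTerm (x := -s ^ (2 * d + j + 2)) (y := -s ^ (j + 1))
    (by rw [norm_neg]; exact norm_pow_lt_one hs _) (by rw [norm_neg]; exact norm_pow_lt_one hs _)
  have hxy : -s ^ (2 * d + j + 2) * -s ^ (j + 1) = s ^ (2 * d + 2 * j + 3) := by ring
  rw [hxy, neg_neg, neg_neg] at h2
  rw [← h2, ← tsum_mul_left]
  convert h1 using 1
  · funext n
    rw [bailey_eq_sum_kernel hs (d + j) d j n (n + 1) rfl (Nat.lt_succ_self n)]
  · refine congrArg 𝓝 (tsum_congr fun r => ?_)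
    rw [thetaTerm_natCast, thetaTerm_neg_natCast, hxy, choose_two_succ,
      ← add_two_mul_choose_two r, neg_pow (s ^ _), neg_pow (s ^ _)]
    have e : r * (r + 1) = 2 * r + 2 * r.choose 2 := by
      have := add_two_mul_choose_two r
      linear_combination -this
    rw [e]
    ring

end Warnaar

/-- Here `s` is the chosen square root `q^{1/2}` of `q`, and `q^{m/2}` is `s ^ m`. -/
theorem mainTheorem3 (k i : ℕ) (hk : 2 ≤ k) (hi : 1 ≤ i) (hik : i ≤ k)
    (q s : ℂ) (hq : ‖q‖ < 1) (hs : s ^ 2 = q) :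
    HasSum
      (fun n : Fin k → ℕ =>
        s ^ (Warnaar.sqSum n + 2 * Warnaar.altSum i n) / Warnaar.denom q n)
      (Warnaar.qPochInf (-s) q *
        (Warnaar.qPochInf (s ^ i) (s ^ (2 * k + 3)) *
          Warnaar.qPochInf (s ^ (2 * k - i + 3)) (s ^ (2 * k + 3)) *
          Warnaar.qPochInf (s ^ (2 * k + 3)) (s ^ (2 * k + 3))) /
        Warnaar.qPochInf q q) := by
  subst hs
  have hs : ‖s‖ < 1 := by
    rw [norm_pow] at hq
    exact lt_of_pow_lt_pow_left₀ 2 zero_le_one (by rwa [one_pow])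
  obtain ⟨k, rfl⟩ : ∃ m, k = m + 1 := ⟨k - 1, by omega⟩
  obtain ⟨j, rfl⟩ : ∃ j, i = j + 1 := ⟨i - 1, by omega⟩
  obtain ⟨d, hd⟩ : ∃ d, k + 1 = d + j := ⟨k + 1 - j, by omega⟩
  obtain ⟨h1, h2⟩ := Warnaar.hasSum_term hs (k := k) hi
  have h3 := Warnaar.tendsto_bailey_of_summable hs h1
  have h4 := Warnaar.tendsto_bailey hs d j
  rw [← hd] at h4
  -- The same transform has two limits: the series over (q;q)_∞, and the product over (q;q)_∞^2.
  have h5 := tendsto_nhds_unique h3 h4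
  have hne := Warnaar.qPochInf_self_ne_zero hq
  refine Eq.subst (motive := HasSum _) ?_ h2
  rw [show 2 * (k + 1) + 3 = 2 * d + 2 * j + 3 by omega,
    show 2 * (k + 1) - (j + 1) + 3 = 2 * d + j + 2 by omega]
  field_simp at h5
  rw [eq_div_iff hne, mul_comm, h5]
  ring
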